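/- Consider a (unitary) two-dimensional rational conformal model with a finite set $P$ of primaries, vacuum $0\in P$, charge conjugation $p\mapsto\bar p$, conformal weights $h_p\in\mathbb{R}$ with $h_0=0$, central charge $c\in\mathbb{R}$, and modular matrix $S\in\mathbb{C}^{P\times P}$. That is: $S$ is symmetric and unitary, $(S^2)_{pq}=\delta_{q,\bar p}$, $(ST)^3=S^2$ for the diagonal matrix $T$ with entries $T_{pp}=e^{2\pi i(h_p-c/24)}$, $S_{0p}>0$ for all $p$, and the numbers given by Verlinde's formula $N_{pq}^r=\sum_s S_{ps}S_{qs}\overline{S_{rs}}/S_{0s}$ (the fusion rule coefficients) are non-negative integers. Let $d_p=S_{0p}/S_{00}$ be the quantum dimensions, and let $\rho_p(\alpha)=S_{\alpha p}/S_{0p}$ be the irreducible representation of the fusion algebra corresponding to the primary $p$. *The deconstruction lattice.* $\mathscr{L}$ is the set, ordered by inclusion, of all subsets $\mathfrak{g}\subseteq P$ that contain $0$ and are such that $p,q\in\mathfrak{g}$ and $N_{pq}^r>0$ imply $r\in\mathfrak{g}$. *Classes and centers.* For $\mathfrak{g}\in\mathscr{L}$, two primaries $p,q$ lie in the same $\mathfrak{g}$-class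 if $\rho_p(\alpha)=\rho_q(\alpha)$ for all $\alpha\in\mathfrak{g}$. The trivial class $\mathfrak{g}^\perp$ is the $\mathfrak{g}$-class of $0$. A $\mathfrak{g}$-class $C$ is central if its mass $\sum_{p\in C}d_p^2$ is minimal among the masses of all $\mathfrak{g}$-classes. The central classes form an abelian group $Z(\mathfrak{g})$, the center of $\mathfrak{g}$, with product $zw=\{r\in P : N_{pq}^r>0\text{ for some }p\in z,\ q\in w\}$ and identity $\mathfrak{g}^\perp$. The central character of $z\in Z(\mathfrak{g})$ is $\varpi_z(\alpha)=\rho_p(\alpha)/d_\alpha$ for $\alpha\in\mathfrak{g}$, with any $p\in z$. *Central quotients.* For a subgroup $H\le Z(\mathfrak{g})$ let $\mathfrak{g}/H=\{\alpha\in\mathfrak{g} : \varpi_z(\alpha)=1\text{ for all }z\in H\}\in\mathscr{L}$. The elements of $\mathscr{L}$ of this form are the central quotients of $\mathfrak{g}$, and $\partial\mathfrak{g}=\mathfrak{g}/Z(\mathfrak{g})$ is the maximal central quotient. *Restriction.* For $\mathfrak{h}\subseteq\mathfrak{g}$ in $\mathscr{L}$, assigning to each central $\mathfrak{g}$-class the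 $\mathfrak{h}$-class containing it is a homomorphism $Z(\mathfrak{g})\to Z(\mathfrak{h})$. Let $Z(\mathfrak{g}|\mathfrak{h})=\{z\in Z(\mathfrak{g}) : z\subseteq\mathfrak{h}^\perp\}$ be its kernel and $I(\mathfrak{g}|\mathfrak{h})\le Z(\mathfrak{h})$ its image. **Lemma.** Let $\mathfrak{g},\mathfrak{h}\in\mathscr{L}$ and suppose that $\mathfrak{h}$ is a central quotient of $\mathfrak{g}$. Then: 1. There is a one-to-one correspondence between $\{\mathfrak{j}\in\mathscr{L} : \mathfrak{h}\subseteq\mathfrak{j}\subseteq\mathfrak{g}\}$ and the set of all subgroups of $Z(\mathfrak{g}|\mathfrak{h})$, given by the mutually inverse maps $\mathfrak{j}\mapsto Z(\mathfrak{g}|\mathfrak{j})$ and $H\mapsto\mathfrak{g}/H$. 2. There is a one-to-one correspondence between $\{\mathfrak{j}\in\mathscr{L} : \partial\mathfrak{g}\subseteq\mathfrak{j}\subseteq\mathfrak{h}\}$ and the set of all subgroups of $I(\mathfrak{g}|\mathfrak{h})$, given by the mutually inverse maps $\mathfrak{j}\mapsto Z(\mathfrak{h}|\mathfrak{j})$ and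 $H\mapsto\mathfrak{h}/H$. -/

import Mathlib

/-- The genus-one data of a (unitary) two-dimensional rational conformal model whose finite set of
primaries is `P`: the vacuum, charge conjugation, conformal weights, the central charge, the modular
matrix `S` and the fusion rule coefficients `N p q r` (the multiplicity of `r` in the fusion
product of `p` and `q`), related to `S` by Verlinde's formula. -/
structure ConformalModel (P : Type*) [Fintype P] [DecidableEq P] where
  /-- the vacuum -/
  vac : P
  /-- charge conjugation -/
  conj : P → P
  /-- fusion rule coefficients -/
  N : P → P → P → ℕ
  /-- conformal weights -/
  weight : P → ℝ
  /-- central charge -/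
  charge : ℝ
  /-- the matrix of the modular transformation `τ ↦ -1/τ` on the chiral characters -/
  S : Matrix P P ℂ
  weight_vac : weight vac = 0
  S_symm : S.transpose = S
  S_unitary : S * S.conjTranspose = 1
  S_sq : S * S = Matrix.of fun p q => if q = conj p then 1 else 0
  modular : (S * Matrix.diagonal fun p =>
    Complex.exp (2 * Real.pi * Complex.I * ((weight p - charge / 24 : ℝ) : ℂ))) ^ 3 = S * S
  S_vac_pos : ∀ p, 0 < (S vac p).re ∧ (S vac p).im = 0
  verlinde : ∀ p q r, (N p q r : ℂ) = ∑ s, S p s * S q s * star (S r s) / S vac s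

namespace ConformalModel

variable {P : Type*} [Fintype P] [DecidableEq P] (M : ConformalModel P)

/-- The quantum dimension of a primary. -/
noncomputable def qdim (p : P) : ℝ := (M.S M.vac p).re / (M.S M.vac M.vac).re

/-- `M.chi p` is the irreducible representation of the fusion algebra that corresponds to the
primary `p`, given by its values on the basis of primaries. -/
noncomputable def chi (p α : P) : ℂ := M.S α p / M.S M.vac p

open Classical in
/-- The mass of a collection of primaries. -/
noncomputable def mass (C : Set P) : ℝ := ∑ p with p ∈ C, M.qdim p ^ 2

/-! ### Elementary facts on the fusion algebra -/

theorem S_comm (p q : P) : M.S p q = M.S q p := by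
  conv_lhs => rw [← M.S_symm]
  rfl

theorem S_vac_re (p : P) : M.S M.vac p = ((M.S M.vac p).re : ℂ) := by
  apply Complex.ext <;> simp [(M.S_vac_pos p).2]

theorem S_vac_ne (p : P) : M.S M.vac p ≠ 0 := by
  intro h
  have := (M.S_vac_pos p).1
  simp [h] at this

theorem S_row (p q : P) : ∑ s, M.S p s * star (M.S q s) = if p = q then 1 else 0 := by
  have := congrFun (congrFun M.S_unitary p) q
  simpa [Matrix.mul_apply, Matrix.one_apply] using this

theorem S_col (p q : P) : ∑ s, M.S s p * star (M.S s q) = if p = q then 1 else 0 := by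
  simp_rw [fun s => M.S_comm s p, fun s => M.S_comm s q]
  exact M.S_row p q

theorem S_conj (p s : P) : M.S (M.conj p) s = star (M.S p s) := by
  have h : (M.S * M.S) * M.S.conjTranspose = M.S := by
    rw [Matrix.mul_assoc, M.S_unitary, Matrix.mul_one]
  rw [M.S_sq] at h
  have := congrFun (congrFun h p) s
  simp [Matrix.mul_apply] at this
  rw [← this, M.S_comm]
  simp

theorem qdim_pos (p : P) : 0 < M.qdim p := div_pos (M.S_vac_pos p).1 (M.S_vac_pos _).1

theorem chi_vac_left (α : P) : M.chi M.vac α = M.qdim α := by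
  rw [chi, qdim, M.S_comm, M.S_vac_re α, M.S_vac_re M.vac]
  simp

theorem chi_vac (p : P) : M.chi p M.vac = 1 := div_self (M.S_vac_ne p)

theorem chi_mul (s p q : P) :
    M.chi s p * M.chi s q = ∑ r, (M.N p q r : ℂ) * M.chi s r := by
  have h : ∑ r, (M.N p q r : ℂ) * M.S r s = M.S p s * M.S q s / M.S M.vac s := by
    simp_rw [M.verlinde, Finset.sum_mul]
    rw [Finset.sum_comm]
    have : ∀ t, ∑ r, M.S p t * M.S q t * star (M.S r t) / M.S M.vac t * M.S r s
        = M.S p t * M.S q t / M.S M.vac t * if s = t then 1 else 0 := by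
      intro t
      rw [← M.S_col s t, Finset.mul_sum]
      exact Finset.sum_congr rfl fun r _ => by ring
    simp_rw [this]
    simp
  simp_rw [chi, ← mul_div_assoc, ← Finset.sum_div, h]
  field_simp

theorem qdim_mul (p q : P) : M.qdim p * M.qdim q = ∑ r, (M.N p q r : ℝ) * M.qdim r := by
  have := M.chi_mul M.vac p q
  simp_rw [chi_vac_left] at this
  exact_mod_cast this

theorem N_comm (p q r : P) : M.N p q r = M.N q p r := by
  have : (M.N p q r : ℂ) = M.N q p r := by
    simp_rw [M.verlinde, mul_comm (M.S p _)]
  exact_mod_cast this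

theorem N_conj (p q r : P) : M.N (M.conj p) r q = M.N p q r := by
  have : (M.N (M.conj p) r q : ℂ) = star (M.N p q r : ℂ) := by
    simp_rw [M.verlinde, S_conj, star_sum, star_div₀, star_mul, star_star]
    refine Finset.sum_congr rfl fun s _ => ?_
    rw [show star (M.S M.vac s) = M.S M.vac s by rw [M.S_vac_re s]; simp]
    ring
  rw [star_natCast] at this
  exact_mod_cast this

theorem N_vac (q r : P) : M.N M.vac q r = if q = r then 1 else 0 := by
  have : (M.N M.vac q r : ℂ) = if q = r then 1 else 0 := by
    rw [← M.S_row q r, M.verlinde]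
    refine Finset.sum_congr rfl fun s _ => ?_
    field_simp [M.S_vac_ne s]
  exact_mod_cast this

theorem chi_conj (p α : P) : M.chi p (M.conj α) = star (M.chi p α) := by
  rw [chi, chi, S_conj, star_div₀]
  congr 1
  rw [M.S_vac_re p]; simp

theorem chi_conj_left (p α : P) : M.chi (M.conj p) α = star (M.chi p α) := by
  rw [chi, chi, M.S_comm, S_conj, star_div₀, M.S_comm M.vac, S_conj, M.S_comm p, M.S_comm p]

theorem chi_symm (p α : P) : M.chi p α * M.qdim p = M.chi α p * M.qdim α := by
  rw [chi, chi, qdim, qdim, M.S_comm α p]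
  push_cast
  rw [← M.S_vac_re p, ← M.S_vac_re α]
  field_simp [M.S_vac_ne p, M.S_vac_ne α]

theorem qdim_conj (p : P) : M.qdim (M.conj p) = M.qdim p := by
  have := M.chi_conj M.vac p
  simp_rw [chi_vac_left] at this
  simpa using this

theorem conj_conj (p : P) : M.conj (M.conj p) = p := by
  have h := M.S_row (M.conj (M.conj p)) p
  simp_rw [S_conj, star_star] at h
  rw [M.S_row, if_pos rfl] at h
  by_contra hne
  rw [if_neg hne] at h
  exact one_ne_zero h

theorem exists_N_pos (p q : P) : ∃ r, 0 < M.N p q r := by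
  by_contra! h
  have h' := M.qdim_mul p q
  have : ∀ r, M.N p q r = 0 := fun r => by have := h r; omega
  simp only [this, Nat.cast_zero, zero_mul, Finset.sum_const_zero] at h'
  exact (mul_pos (M.qdim_pos p) (M.qdim_pos q)).ne' h'

theorem norm_chi_le (p α : P) : ‖M.chi p α‖ ≤ M.qdim α := by
  obtain ⟨γ, -, hγ⟩ := Finset.exists_max_image Finset.univ
    (fun γ => ‖M.chi p γ‖ / M.qdim γ) ⟨M.vac, Finset.mem_univ _⟩
  set m := ‖M.chi p γ‖ / M.qdim γ with hm
  have hle : ∀ δ, ‖M.chi p δ‖ ≤ m * M.qdim δ := fun δ =>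
    (div_le_iff₀ (M.qdim_pos δ)).1 (hγ δ (Finset.mem_univ _))
  have hmpos : 0 < m := by
    have := hle M.vac
    rw [chi_vac, norm_one] at this
    by_contra! h
    nlinarith [M.qdim_pos M.vac]
  have hγ' : ‖M.chi p γ‖ = m * M.qdim γ := by
    rw [hm, div_mul_cancel₀ _ (M.qdim_pos γ).ne']
  have h1 : ‖M.chi p α‖ * (m * M.qdim γ) ≤ m * (M.qdim α * M.qdim γ) := by
    rw [← hγ', ← norm_mul, chi_mul, qdim_mul, Finset.mul_sum]
    refine (norm_sum_le _ _).trans (Finset.sum_le_sum fun δ _ => ?_)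
    rw [norm_mul, Complex.norm_natCast]
    calc _ ≤ (M.N α γ δ : ℝ) * (m * M.qdim δ) := by gcongr; exact hle δ
      _ = _ := by ring
  have := mul_pos hmpos (M.qdim_pos γ)
  nlinarith

/-- If `ρ_α` takes values of maximal modulus on `p` and `q`, then it is multiplicative (up to
the quantum dimensions) on the constituents of their fusion product. -/
theorem chi_of_norm {α p q r : P} {u v : ℂ} (hu : ‖u‖ = 1) (hv : ‖v‖ = 1)
    (hp : M.chi α p = u * M.qdim p) (hq : M.chi α q = v * M.qdim q) (hr : 0 < M.N p q r) :
    M.chi α r = u * v * M.qdim r := by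
  have hw : ‖u * v‖ = 1 := by rw [norm_mul, hu, hv, one_mul]
  set w := u * v with hwdef
  have hsw : star w * w = 1 := by
    rw [Complex.star_def, Complex.conj_mul', hw]; simp
  have hre : ∀ t, (star w * M.chi α t).re ≤ M.qdim t := fun t => by
    refine (Complex.re_le_norm _).trans ?_
    rw [norm_mul, norm_star, hw, one_mul]
    exact M.norm_chi_le α t
  have hsum : ∑ t, (M.N p q t : ℝ) * (star w * M.chi α t).re
      = ∑ t, (M.N p q t : ℝ) * M.qdim t := by
    have h1 := M.chi_mul α p q
    rw [hp, hq] at h1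
    have h2 : star w * ∑ t, (M.N p q t : ℂ) * M.chi α t = (M.qdim p * M.qdim q : ℝ) := by
      rw [← h1]
      push_cast
      linear_combination ((M.qdim p : ℂ) * M.qdim q) * hsw
    have h3 := congrArg Complex.re h2
    rw [Complex.ofReal_re, qdim_mul, Finset.mul_sum, Complex.re_sum] at h3
    rw [← h3]
    refine Finset.sum_congr rfl fun t _ => ?_
    rw [mul_left_comm, ← Complex.ofReal_natCast, Complex.re_ofReal_mul]
  have heq := (Finset.sum_eq_sum_iff_of_le (fun t _ =>
    mul_le_mul_of_nonneg_left (hre t) (Nat.cast_nonneg (M.N p q t)))).1 hsum r (Finset.mem_univ _)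
  have hr' : (star w * M.chi α r).re = M.qdim r :=
    mul_left_cancel₀ (by exact_mod_cast hr.ne') heq
  have hn : ‖star w * M.chi α r‖ ≤ M.qdim r := by
    rw [norm_mul, norm_star, hw, one_mul]; exact M.norm_chi_le α r
  have him : (star w * M.chi α r).im = 0 := by
    have h1 := Complex.sq_norm (star w * M.chi α r)
    rw [Complex.normSq_apply, hr'] at h1
    have h2 := pow_le_pow_left₀ (norm_nonneg _) hn 2
    nlinarith [mul_self_nonneg (star w * M.chi α r).im]
  have hfin : star w * M.chi α r = M.qdim r := by
    apply Complex.ext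
    · rw [hr', Complex.ofReal_re]
    · rw [him, Complex.ofReal_im]
  rw [← hfin]
  linear_combination (-M.chi α r) * hsw

/-! ### The deconstruction lattice -/

/-- An element of the deconstruction lattice: a set of primaries that contains the vacuum and is
closed under the fusion product. -/
structure DecLattice where
  /-- the underlying set of primaries -/
  carrier : Set P
  vac_mem : M.vac ∈ carrier
  fusion_mem : ∀ p q r, p ∈ carrier → q ∈ carrier → 0 < M.N p q r → r ∈ carrier

namespace DecLattice

variable {M}

instance : SetLike M.DecLattice P where
  coe := carrier
  coe_injective := by rintro ⟨_, _, _⟩ ⟨_, _, _⟩ h; congr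

/-- The ordering of the deconstruction lattice is set inclusion. -/
instance : PartialOrder M.DecLattice := PartialOrder.ofSetLike M.DecLattice P

variable (g h : M.DecLattice)

/-- Two primaries are in the same `g`-class if the corresponding irreducible representations of
the fusion algebra coincide on the elements of `g`. -/
def classSetoid : Setoid P where
  r p q := ∀ α ∈ g, M.chi p α = M.chi q α
  iseqv := ⟨fun _ _ _ => rfl, fun h α hα => (h α hα).symm,
    fun h k α hα => (h α hα).trans (k α hα)⟩

/-- The collection of all `g`-classes. -/
def classes : Set (Set P) := g.classSetoid.classes

/-- The `g`-class containing the primary `p`. -/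
def classOf (p : P) : Set P := {q | g.classSetoid q p}

/-- The duality map: `g.dual` is the trivial class, i.e. the `g`-class of the vacuum. -/
def dual : M.DecLattice where
  carrier := g.classOf M.vac
  vac_mem := g.classSetoid.refl _
  fusion_mem p q r hp hq hr α hα := by
    have key : ∀ t, M.chi t α = M.chi M.vac α ↔ M.chi α t = 1 * M.qdim t := fun t => by
      have h1 := M.chi_symm t α
      have ht : (M.qdim t : ℂ) ≠ 0 := by exact_mod_cast (M.qdim_pos t).ne'
      have hα : (M.qdim α : ℂ) ≠ 0 := by exact_mod_cast (M.qdim_pos α).ne'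
      rw [M.chi_vac_left, one_mul]
      constructor
      · intro h
        rw [h, mul_comm] at h1
        exact (mul_right_cancel₀ hα h1).symm
      · intro h
        rw [h, mul_comm (M.qdim t : ℂ)] at h1
        exact mul_right_cancel₀ ht h1
    rw [key]
    simpa using M.chi_of_norm (u := 1) (v := 1) (by simp) (by simp)
      ((key p).1 (hp α hα)) ((key q).1 (hq α hα)) hr

/-- A `g`-class is central if its mass is minimal among the masses of all `g`-classes. -/
def IsCentralClass (C : Set P) : Prop :=
  C ∈ g.classes ∧ ∀ C' ∈ g.classes, M.mass C ≤ M.mass C'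

/-- The center of `g`: the collection of all central `g`-classes. -/
structure Center where
  /-- a central class, as a set of primaries -/
  carrier : Set P
  isCentral : g.IsCentralClass carrier

variable {g h}

theorem mem_classOf {p q : P} : q ∈ g.classOf p ↔ ∀ α ∈ g, M.chi q α = M.chi p α := Iff.rfl

theorem self_mem_classOf (p : P) : p ∈ g.classOf p := fun _ _ => rfl

theorem classOf_mem (p : P) : g.classOf p ∈ g.classes := ⟨p, rfl⟩

theorem eq_classOf {C : Set P} (hC : C ∈ g.classes) {p : P} (hp : p ∈ C) : C = g.classOf p := by
  obtain ⟨q, rfl⟩ := hC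
  ext r
  exact ⟨fun hr => g.classSetoid.trans hr (g.classSetoid.symm hp),
    fun hr => g.classSetoid.trans hr hp⟩

theorem classOf_eq {p q : P} (H : ∀ α ∈ g, M.chi p α = M.chi q α) : g.classOf p = g.classOf q :=
  eq_classOf (classOf_mem p) (fun α hα => (H α hα).symm)

open Classical in
theorem conj_mem {p : P} (hp : p ∈ g) : M.conj p ∈ g := by
  by_contra hc
  have h1 : ∀ α ∈ g, ∑ γ with γ ∈ g, (M.N p α γ : ℝ) * M.qdim γ = M.qdim p * M.qdim α := by
    intro α hα
    rw [M.qdim_mul, Finset.sum_filter]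
    refine Finset.sum_congr rfl fun γ _ => ?_
    split_ifs with hγ
    · rfl
    · have : M.N p α γ = 0 := by
        by_contra h0
        exact hγ (g.fusion_mem p α γ hp hα (Nat.pos_of_ne_zero h0))
      simp [this]
  have h2 : ∀ γ ∈ g, ∑ α with α ∈ g, (M.N p α γ : ℝ) * M.qdim α ≤ M.qdim p * M.qdim γ := by
    intro γ _
    rw [← M.qdim_conj p, M.qdim_mul, Finset.sum_filter]
    refine Finset.sum_le_sum fun α _ => ?_
    rw [M.N_conj]
    split_ifs
    · rfl
    · exact mul_nonneg (Nat.cast_nonneg _) (M.qdim_pos α).le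
  have h3 : ∑ α with α ∈ g, (M.N p α M.vac : ℝ) * M.qdim α = 0 := by
    refine Finset.sum_eq_zero fun α hα => ?_
    rw [← M.N_conj, M.N_comm, M.N_vac, if_neg, Nat.cast_zero, zero_mul]
    rintro rfl
    exact hc (Finset.mem_filter.1 hα).2
  have e1 : ∑ α with α ∈ g, M.qdim α * ∑ γ with γ ∈ g, (M.N p α γ : ℝ) * M.qdim γ
      = ∑ γ with γ ∈ g, M.qdim γ * ∑ α with α ∈ g, (M.N p α γ : ℝ) * M.qdim α := by
    simp_rw [Finset.mul_sum]
    rw [Finset.sum_comm]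
    exact Finset.sum_congr rfl fun _ _ => Finset.sum_congr rfl fun _ _ => by ring
  have e2 : ∑ γ with γ ∈ g, M.qdim γ * ∑ α with α ∈ g, (M.N p α γ : ℝ) * M.qdim α
      < ∑ γ with γ ∈ g, M.qdim γ * (M.qdim p * M.qdim γ) := by
    refine Finset.sum_lt_sum (fun γ hγ => ?_)
      ⟨M.vac, Finset.mem_filter.2 ⟨Finset.mem_univ _, g.vac_mem⟩, ?_⟩
    · exact mul_le_mul_of_nonneg_left (h2 γ (Finset.mem_filter.1 hγ).2) (M.qdim_pos γ).le
    · rw [h3, mul_zero]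
      have := M.qdim_pos M.vac
      have := M.qdim_pos p
      positivity
  rw [← e1] at e2
  refine e2.ne (Finset.sum_congr rfl fun α hα => ?_)
  rw [h1 α (Finset.mem_filter.1 hα).2]

open Classical in
theorem sum_chi_eq_zero {p q : P} (hpq : q ∉ g.classOf p) :
    ∑ α with α ∈ g, star (M.chi p α) * M.chi q α = 0 := by
  rw [mem_classOf] at hpq
  push Not at hpq
  obtain ⟨β, hβ, hne⟩ := hpq
  have key : M.chi q β * ∑ α with α ∈ g, star (M.chi p α) * M.chi q α
      = M.chi p β * ∑ α with α ∈ g, star (M.chi p α) * M.chi q α := by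
    have l : ∀ α ∈ g, M.chi q β * M.chi q α
        = ∑ γ with γ ∈ g, (M.N β α γ : ℂ) * M.chi q γ := by
      intro α hα
      rw [M.chi_mul, Finset.sum_filter]
      refine Finset.sum_congr rfl fun γ _ => ?_
      split_ifs with hγ
      · rfl
      · have : M.N β α γ = 0 := by
          by_contra h0
          exact hγ (g.fusion_mem β α γ hβ hα (Nat.pos_of_ne_zero h0))
        simp [this]
    have r : ∀ γ ∈ g, M.chi p β * star (M.chi p γ)
        = ∑ α with α ∈ g, (M.N β α γ : ℂ) * star (M.chi p α) := by
      intro γ hγ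
      have h1 := congrArg star (M.chi_mul p (M.conj β) γ)
      rw [M.chi_conj, star_mul', star_star, star_sum] at h1
      rw [h1, Finset.sum_filter]
      refine Finset.sum_congr rfl fun α _ => ?_
      rw [M.N_conj]
      split_ifs with hα
      · rw [star_mul', star_natCast]
      · have : M.N β α γ = 0 := by
          by_contra h0
          rw [← M.N_conj] at h0
          exact hα (g.fusion_mem _ γ α (conj_mem hβ) hγ (Nat.pos_of_ne_zero h0))
        simp [this]
    calc _ = ∑ α with α ∈ g, star (M.chi p α) *
          ∑ γ with γ ∈ g, (M.N β α γ : ℂ) * M.chi q γ := by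
          rw [Finset.mul_sum]
          refine Finset.sum_congr rfl fun α hα => ?_
          rw [← l α (Finset.mem_filter.1 hα).2]; ring
      _ = ∑ γ with γ ∈ g, (∑ α with α ∈ g, (M.N β α γ : ℂ) * star (M.chi p α)) *
          M.chi q γ := by
          simp_rw [Finset.mul_sum, Finset.sum_mul]
          rw [Finset.sum_comm]
          exact Finset.sum_congr rfl fun _ _ => Finset.sum_congr rfl fun _ _ => by ring
      _ = _ := by
          rw [Finset.mul_sum]
          refine Finset.sum_congr rfl fun γ hγ => ?_
          rw [← r γ (Finset.mem_filter.1 hγ).2]; ring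
  by_contra h0
  exact hne (mul_right_cancel₀ h0 key)

open Classical in
theorem mass_classOf (p : P) :
    M.mass (g.classOf p) * ∑ α with α ∈ g, ‖M.chi p α‖ ^ 2
      = 1 / (M.S M.vac M.vac).re ^ 2 := by
  have hs : (M.S M.vac M.vac) ≠ 0 := M.S_vac_ne _
  have h1 : ∀ q, (M.qdim q : ℂ) ^ 2 * ∑ α with α ∈ g, star (M.chi p α) * M.chi q α
      = if q ∈ g.classOf p then
          (M.qdim q : ℂ) ^ 2 * ((∑ α with α ∈ g, ‖M.chi p α‖ ^ 2 : ℝ) : ℂ) else 0 := by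
    intro q
    split_ifs with hq
    · congr 1
      push_cast
      refine Finset.sum_congr rfl fun α hα => ?_
      rw [mem_classOf.1 hq α (Finset.mem_filter.1 hα).2, Complex.star_def, Complex.conj_mul']
    · rw [sum_chi_eq_zero hq, mul_zero]
  have h2 : ∀ α, ∑ q, (M.qdim q : ℂ) ^ 2 * M.chi q α
      = if α = M.vac then 1 / (M.S M.vac M.vac) ^ 2 else 0 := by
    intro α
    have : ∀ q, (M.qdim q : ℂ) ^ 2 * M.chi q α
        = M.S α q * star (M.S M.vac q) / (M.S M.vac M.vac) ^ 2 := by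
      intro q
      rw [chi, qdim]
      push_cast
      rw [← M.S_vac_re q, ← M.S_vac_re M.vac,
        show star (M.S M.vac q) = M.S M.vac q by rw [M.S_vac_re q]; simp]
      field_simp [M.S_vac_ne q]
    simp_rw [this]
    rw [← Finset.sum_div, M.S_row]
    split_ifs <;> simp
  have h3 : (M.mass (g.classOf p) : ℂ) * ((∑ α with α ∈ g, ‖M.chi p α‖ ^ 2 : ℝ) : ℂ)
      = 1 / (M.S M.vac M.vac) ^ 2 := by
    calc _ = ∑ q, (M.qdim q : ℂ) ^ 2 * ∑ α with α ∈ g, star (M.chi p α) * M.chi q α := by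
          simp_rw [h1]
          rw [← Finset.sum_filter, ← Finset.sum_mul, mass]
          push_cast
          rfl
      _ = ∑ α with α ∈ g, star (M.chi p α) * ∑ q, (M.qdim q : ℂ) ^ 2 * M.chi q α := by
          simp_rw [Finset.mul_sum]
          rw [Finset.sum_comm]
          exact Finset.sum_congr rfl fun _ _ => Finset.sum_congr rfl fun _ _ => by ring
      _ = _ := by
          simp_rw [h2]
          rw [Finset.sum_eq_single M.vac]
          · rw [if_pos rfl, M.chi_vac, star_one, one_mul]
          · intro α _ hα
            rw [if_neg hα, mul_zero]
          · intro hn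
            exact absurd (Finset.mem_filter.2 ⟨Finset.mem_univ _, g.vac_mem⟩) hn
  rw [M.S_vac_re M.vac] at h3
  exact_mod_cast h3

/-- Central classes are those on which the representations of the fusion algebra have maximal
modulus. -/
theorem isCentralClass_classOf {p : P} :
    g.IsCentralClass (g.classOf p) ↔ ∀ α ∈ g, ‖M.chi p α‖ = M.qdim α := by
  classical
  have hs : 0 < 1 / (M.S M.vac M.vac).re ^ 2 := by
    have := (M.S_vac_pos M.vac).1
    positivity
  have hle : ∀ q, ∀ α ∈ Finset.univ.filter (fun α => α ∈ g),
      ‖M.chi q α‖ ^ 2 ≤ M.qdim α ^ 2 :=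
    fun q α _ => pow_le_pow_left₀ (norm_nonneg _) (M.norm_chi_le q α) 2
  have hK : ∀ q, 0 < ∑ α with α ∈ g, ‖M.chi q α‖ ^ 2 := fun q =>
    Finset.sum_pos' (fun _ _ => by positivity)
      ⟨M.vac, Finset.mem_filter.2 ⟨Finset.mem_univ _, g.vac_mem⟩, by simp [M.chi_vac]⟩
  have hm : ∀ q, 0 < M.mass (g.classOf q) := fun q => by
    have := mass_classOf (g := g) q
    rw [← this] at hs
    exact pos_of_mul_pos_left hs (hK q).le
  have h0 : ∑ α with α ∈ g, ‖M.chi M.vac α‖ ^ 2 = ∑ α with α ∈ g, M.qdim α ^ 2 :=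
    Finset.sum_congr rfl fun α _ => by
      rw [M.chi_vac_left, Complex.norm_real, Real.norm_of_nonneg (M.qdim_pos α).le]
  constructor
  · intro hc α hα
    have h1 := hc.2 _ (classOf_mem M.vac)
    have h2 : ∑ α with α ∈ g, M.qdim α ^ 2 ≤ ∑ α with α ∈ g, ‖M.chi p α‖ ^ 2 := by
      rw [← h0]
      by_contra! hlt
      have e1 := mass_classOf (g := g) p
      have e2 := mass_classOf (g := g) M.vac
      have := mul_lt_mul' h1 hlt (hK p).le (hm M.vac)
      linarith
    have h3 := (Finset.sum_eq_sum_iff_of_le (hle p)).1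
      (le_antisymm (Finset.sum_le_sum (hle p)) h2) α
      (Finset.mem_filter.2 ⟨Finset.mem_univ _, hα⟩)
    exact (pow_left_inj₀ (norm_nonneg _) (M.qdim_pos α).le two_ne_zero).1 h3
  · intro H
    refine ⟨classOf_mem p, fun C' hC' => ?_⟩
    obtain ⟨q, rfl⟩ := hC'
    change M.mass (g.classOf p) ≤ M.mass (g.classOf q)
    have e1 := mass_classOf (g := g) p
    have e2 := mass_classOf (g := g) q
    have h1 : ∑ α with α ∈ g, ‖M.chi q α‖ ^ 2 ≤ ∑ α with α ∈ g, ‖M.chi p α‖ ^ 2 := by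
      refine Finset.sum_le_sum fun α hα => ?_
      rw [H α (Finset.mem_filter.1 hα).2]
      exact hle q α hα
    by_contra! hlt
    have := mul_lt_mul' h1 hlt (hm q).le (hK p)
    linarith

/-! ### The center as an abelian group -/

namespace Center

theorem ext_carrier {z w : g.Center} (H : z.1 = w.1) : z = w := by
  cases z; cases w; cases H; rfl

theorem nonempty (z : g.Center) : ∃ p, p ∈ z.1 := by
  obtain ⟨p, hp⟩ := z.2.1
  exact ⟨p, by rw [hp]; exact g.classSetoid.refl p⟩

/-- The central character of a central class. -/
noncomputable def char (z : g.Center) (α : P) : ℂ := M.chi z.nonempty.choose α / M.qdim α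

theorem eq_classOf (z : g.Center) {p : P} (hp : p ∈ z.1) : z.1 = g.classOf p :=
  DecLattice.eq_classOf z.2.1 hp

/-- The central character does not depend on the choice of the representative. -/
theorem chi_eq (z : g.Center) {p α : P} (hp : p ∈ z.1) (hα : α ∈ g) :
    M.chi p α = z.char α * M.qdim α := by
  have hq : (M.qdim α : ℂ) ≠ 0 := by exact_mod_cast (M.qdim_pos α).ne'
  rw [char, div_mul_cancel₀ _ hq]
  have := z.nonempty.choose_spec
  rw [z.eq_classOf this] at hp
  exact hp α hα

theorem norm_char (z : g.Center) {α : P} (hα : α ∈ g) : ‖z.char α‖ = 1 := by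
  have hs := z.nonempty.choose_spec
  have h := z.2
  rw [z.eq_classOf hs, isCentralClass_classOf] at h
  rw [char, norm_div, h α hα, Complex.norm_real, Real.norm_of_nonneg (M.qdim_pos α).le,
    div_self (M.qdim_pos α).ne']

theorem mem_iff (z : g.Center) {p : P} :
    p ∈ z.1 ↔ ∀ α ∈ g, M.chi p α = z.char α * M.qdim α := by
  refine ⟨fun hp α hα => z.chi_eq hp hα, fun H => ?_⟩
  obtain ⟨q, hq⟩ := z.nonempty
  rw [z.eq_classOf hq]
  exact fun α hα => (H α hα).trans (z.chi_eq hq hα).symm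

theorem ext_char {z w : g.Center} (H : ∀ α ∈ g, z.char α = w.char α) : z = w := by
  apply ext_carrier
  ext p
  rw [mem_iff, mem_iff]
  exact forall₂_congr fun α hα => by rw [H α hα]

/-- The central character as a character of the fusion closed set `g`. -/
theorem char_fusion (z : g.Center) {α β γ : P} (hα : α ∈ g) (hβ : β ∈ g)
    (hN : 0 < M.N α β γ) : z.char γ = z.char α * z.char β := by
  obtain ⟨p, hp⟩ := z.nonempty
  have hγ : γ ∈ g := g.fusion_mem α β γ hα hβ hN
  have h := M.chi_of_norm (z.norm_char hα) (z.norm_char hβ) (z.chi_eq hp hα) (z.chi_eq hp hβ) hN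
  rw [z.chi_eq hp hγ] at h
  exact mul_right_cancel₀ (by exact_mod_cast (M.qdim_pos γ).ne') h

/-- For a central class, the value of `ρ_α` on its elements. -/
theorem chi_swap (z : g.Center) {p α : P} (hp : p ∈ z.1) (hα : α ∈ g) :
    M.chi α p = z.char α * M.qdim p := by
  have h := M.chi_symm p α
  rw [z.chi_eq hp hα] at h
  refine mul_right_cancel₀ (b := (M.qdim α : ℂ)) (by exact_mod_cast (M.qdim_pos α).ne') ?_
  rw [← h]; ring

theorem chi_fusion (z w : g.Center) {p q r : P} (hp : p ∈ z.1) (hq : q ∈ w.1)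
    (hN : 0 < M.N p q r) {α : P} (hα : α ∈ g) :
    M.chi r α = z.char α * w.char α * M.qdim α := by
  have h := M.chi_of_norm (z.norm_char hα) (w.norm_char hα) (z.chi_swap hp hα)
    (w.chi_swap hq hα) hN
  have h2 := M.chi_symm r α
  rw [h] at h2
  refine mul_right_cancel₀ (b := (M.qdim r : ℂ)) (by exact_mod_cast (M.qdim_pos r).ne') ?_
  rw [h2]; ring

/-- A `g`-class whose values are given by a function of modulus one is central. -/
theorem central_of_chi {C : Set P} {u : P → ℂ} (hne : C.Nonempty)
    (hC : ∀ p, p ∈ C ↔ ∀ α ∈ g, M.chi p α = u α * M.qdim α) (hu : ∀ α ∈ g, ‖u α‖ = 1) :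
    g.IsCentralClass C := by
  obtain ⟨p, hp⟩ := hne
  have : C = g.classOf p := by
    ext q
    rw [hC, mem_classOf]
    exact forall₂_congr fun α hα => by rw [(hC p).1 hp α hα]
  rw [this, isCentralClass_classOf]
  intro α hα
  rw [(hC p).1 hp α hα, norm_mul, hu α hα, one_mul, Complex.norm_real,
    Real.norm_of_nonneg (M.qdim_pos α).le]

theorem mem_mul_iff (z w : g.Center) (r : P) :
    r ∈ {r | ∃ p ∈ z.1, ∃ q ∈ w.1, 0 < M.N p q r} ↔
      ∀ α ∈ g, M.chi r α = (z.char α * w.char α) * M.qdim α := by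
  constructor
  · rintro ⟨p, hp, q, hq, hN⟩ α hα
    exact chi_fusion z w hp hq hN hα
  · intro H
    obtain ⟨p, hp⟩ := z.nonempty
    obtain ⟨q, hq⟩ := M.exists_N_pos (M.conj p) r
    refine ⟨p, hp, q, ?_, by rwa [← M.N_conj]⟩
    rw [mem_iff]
    intro α hα
    have hs : star (z.char α) * z.char α = 1 := by
      rw [Complex.star_def, Complex.conj_mul', z.norm_char hα]; simp
    have h1 : M.chi α (M.conj p) = star (z.char α) * M.qdim (M.conj p) := by
      rw [M.chi_conj, z.chi_swap hp hα, star_mul', M.qdim_conj]; simp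
    have h2 : M.chi α r = z.char α * w.char α * M.qdim r := by
      have h := M.chi_symm r α
      rw [H α hα] at h
      refine mul_right_cancel₀ (b := (M.qdim α : ℂ)) (by exact_mod_cast (M.qdim_pos α).ne') ?_
      rw [← h]; ring
    have h3 := M.chi_of_norm (by rw [norm_star, z.norm_char hα])
      (by rw [norm_mul, z.norm_char hα, w.norm_char hα, one_mul]) h1 h2 hq
    have h := M.chi_symm q α
    rw [h3] at h
    refine mul_right_cancel₀ (b := (M.qdim q : ℂ)) (by exact_mod_cast (M.qdim_pos q).ne') ?_
    rw [h]
    linear_combination (w.char α * M.qdim q * M.qdim α) * hs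

/-- The product of two central classes consists of all constituents of the fusion products of
their elements. -/
instance : Mul g.Center where
  mul z w := ⟨{r | ∃ p ∈ z.1, ∃ q ∈ w.1, 0 < M.N p q r}, by
    obtain ⟨p, hp⟩ := z.nonempty
    obtain ⟨q, hq⟩ := w.nonempty
    obtain ⟨r, hr⟩ := M.exists_N_pos p q
    exact central_of_chi ⟨r, p, hp, q, hq, hr⟩ (mem_mul_iff z w)
      fun α hα => by rw [norm_mul, z.norm_char hα, w.norm_char hα, one_mul]⟩

/-- The identity element of the center is the trivial class. -/
instance : One g.Center where
  one := ⟨g.dual, central_of_chi (u := fun _ => 1) ⟨M.vac, g.dual.vac_mem⟩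
    (fun p => forall₂_congr fun α _ => by rw [M.chi_vac_left, one_mul]) (fun _ _ => by simp)⟩

/-- The inverse of a central class consists of the charge conjugates of its elements. -/
instance : Inv g.Center where
  inv z := ⟨{p | M.conj p ∈ z.1}, by
    obtain ⟨p, hp⟩ := z.nonempty
    refine central_of_chi (u := fun α => star (z.char α)) ⟨M.conj p, ?_⟩ (fun q => ?_)
      fun α hα => by rw [norm_star, z.norm_char hα]
    · rwa [Set.mem_ofPred_eq, M.conj_conj]
    · rw [Set.mem_ofPred_eq, mem_iff]
      refine forall₂_congr fun α _ => ?_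
      rw [M.chi_conj_left]
      constructor
      · intro h
        have := congrArg star h
        simpa using this
      · intro h
        rw [h]; simp⟩

theorem char_eq_of_mem {z : g.Center} {p α : P} {u : ℂ} (hp : p ∈ z.1) (hα : α ∈ g)
    (h : M.chi p α = u * M.qdim α) : z.char α = u := by
  rw [z.chi_eq hp hα] at h
  exact mul_right_cancel₀ (by exact_mod_cast (M.qdim_pos α).ne') h

theorem char_mul (z w : g.Center) {α : P} (hα : α ∈ g) :
    (z * w).char α = z.char α * w.char α := by
  obtain ⟨r, hr⟩ := (z * w).nonempty
  exact char_eq_of_mem hr hα ((mem_mul_iff z w r).1 hr α hα)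

theorem char_one {α : P} (hα : α ∈ g) : (1 : g.Center).char α = 1 :=
  char_eq_of_mem (p := M.vac) g.dual.vac_mem hα (by rw [M.chi_vac_left, one_mul])

theorem char_inv (z : g.Center) {α : P} (hα : α ∈ g) : (z⁻¹).char α = star (z.char α) := by
  obtain ⟨p, hp⟩ := (z⁻¹).nonempty
  have h := z.chi_eq (p := M.conj p) hp hα
  rw [M.chi_conj_left] at h
  refine char_eq_of_mem hp hα ?_
  have := congrArg star h
  simpa using this

/-- The center is an abelian group. -/
instance : CommGroup g.Center where
  mul_assoc a b c := ext_char fun α hα => by simp only [char_mul _ _ hα, mul_assoc]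
  one_mul a := ext_char fun α hα => by rw [char_mul _ _ hα, char_one hα, one_mul]
  mul_one a := ext_char fun α hα => by rw [char_mul _ _ hα, char_one hα, mul_one]
  mul_comm a b := ext_char fun α hα => by simp only [char_mul _ _ hα, mul_comm]
  inv_mul_cancel a := ext_char fun α hα => by
    rw [char_mul _ _ hα, char_one hα, char_inv _ hα, Complex.star_def, Complex.conj_mul',
      a.norm_char hα]
    simp

end Center

/-! ### Central quotients and the restriction homomorphism -/

/-- The central quotient `g / H`: the elements of `g` on which the central characters of all
elements of `H` are trivial. -/
def quotient (g : M.DecLattice) (H : Subgroup g.Center) : M.DecLattice where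
  carrier := {α | α ∈ g ∧ ∀ z ∈ H, z.char α = 1}
  vac_mem := ⟨g.vac_mem, fun z _ => by
    obtain ⟨p, hp⟩ := z.nonempty
    refine Center.char_eq_of_mem hp g.vac_mem ?_
    rw [M.chi_vac, one_mul, qdim, div_self (M.S_vac_pos _).1.ne', Complex.ofReal_one]⟩
  fusion_mem p q r hp hq hN := ⟨g.fusion_mem p q r hp.1 hq.1 hN, fun z hz => by
    rw [z.char_fusion hp.1 hq.1 hN, hp.2 z hz, hq.2 z hz, one_mul]⟩

/-- `h` is a central quotient of `g`. -/
def IsCentralQuotient (h g : M.DecLattice) : Prop := ∃ H : Subgroup g.Center, h = g.quotient H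

theorem IsCentralQuotient.le {h g : M.DecLattice} (H : h.IsCentralQuotient g) : h ≤ g := by
  obtain ⟨H, rfl⟩ := H
  exact fun _ hα => hα.1

/-- The maximal central quotient of `g`. -/
def maxQuotient (g : M.DecLattice) : M.DecLattice := g.quotient ⊤

theorem mem_res_iff {g h : M.DecLattice} (hle : h ≤ g) (z : g.Center) (p : P) :
    p ∈ {p | ∃ q ∈ z.1, h.classSetoid p q} ↔
      ∀ α ∈ h, M.chi p α = z.char α * M.qdim α := by
  constructor
  · rintro ⟨q, hq, hpq⟩ α hα
    rw [← z.chi_eq hq (hle hα)]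
    exact hpq α hα
  · intro H
    obtain ⟨q, hq⟩ := z.nonempty
    exact ⟨q, hq, fun α hα => (H α hα).trans (z.chi_eq hq (hle hα)).symm⟩

/-- For `h ⊆ g`, the `h`-class that contains a given central `g`-class. -/
def resClass {g h : M.DecLattice} (hle : h ≤ g) (z : g.Center) : h.Center where
  carrier := {p | ∃ q ∈ z.1, h.classSetoid p q}
  isCentral := by
    obtain ⟨q, hq⟩ := z.nonempty
    exact Center.central_of_chi ⟨q, q, hq, h.classSetoid.refl q⟩ (mem_res_iff hle z)
      fun α hα => z.norm_char (hle hα)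

theorem char_resClass {g h : M.DecLattice} (hle : h ≤ g) (z : g.Center) {α : P} (hα : α ∈ h) :
    (resClass hle z).char α = z.char α := by
  obtain ⟨q, hq⟩ := z.nonempty
  exact Center.char_eq_of_mem (p := q) ⟨q, hq, h.classSetoid.refl q⟩ hα (z.chi_eq hq (hle hα))

/-- For `h ⊆ g`, the restriction homomorphism assigns to each central `g`-class the
`h`-class that contains it. -/
def res {g h : M.DecLattice} (hle : h ≤ g) : g.Center →* h.Center where
  toFun := resClass hle
  map_one' := Center.ext_char fun α hα => by
    rw [char_resClass hle _ hα, Center.char_one hα, Center.char_one (hle hα)]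
  map_mul' z w := Center.ext_char fun α hα => by
    rw [char_resClass hle _ hα, Center.char_mul _ _ hα, Center.char_mul _ _ (hle hα),
      char_resClass hle _ hα, char_resClass hle _ hα]

/-- `Z(g|h)`, the kernel of the restriction homomorphism. -/
def ZR {g h : M.DecLattice} (hle : h ≤ g) : Subgroup g.Center := (res hle).ker

/-- `I(g|h)`, the image of the restriction homomorphism. -/
def IR {g h : M.DecLattice} (hle : h ≤ g) : Subgroup h.Center := (res hle).range

/-- `Z(g|h)` consists of the central `g`-classes contained in the trivial class of `h`. -/
theorem mem_ZR {g h : M.DecLattice} (hle : h ≤ g) (z : g.Center) :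
    z ∈ ZR hle ↔ z.1 ⊆ (h.dual : Set P) := by
  rw [ZR, MonoidHom.mem_ker]
  constructor
  · intro H p hp
    have : p ∈ (res hle z).1 := ⟨p, hp, h.classSetoid.refl p⟩
    rw [H] at this
    exact this
  · intro H
    obtain ⟨p, hp⟩ := z.nonempty
    have h1 : p ∈ (res hle z).1 := ⟨p, hp, h.classSetoid.refl p⟩
    apply Center.ext_carrier
    rw [Center.eq_classOf _ h1, Center.eq_classOf (1 : h.Center) (p := p) (H hp)]

end DecLattice

end ConformalModel

namespace ConformalModel

namespace DecLattice

variable {P : Type*} [Fintype P] [DecidableEq P] {M : ConformalModel P} {g h : M.DecLattice}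

namespace Center

/-! The pairing of `g` with its center given by values of central characters is a Galois connection:
`g.quotient H` and `ZR` are mutual annihilators. Both parts say that suitable closed elements
exhaust the interval and the subgroups, and both follow from one statement: if `l = g.quotient K`,
the interval from `l` to `g` corresponds to the subgroups of `K` (`iccEquivSubgroup`).

That every subgroup is closed (`ZR_quotient`) and every intermediate element is closed
(`quotient_ZR`) are double counting arguments. They combine two orthogonality relations: over `g`,
nontrivial central characters weighted by squared quantum dimensions sum to zero; over a finite
subgroup of the center, so do nontrivial evaluation characters.

For the first part take `K = Z(g|h)`. For the second, the maximal quotient of `g` is the quotient of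
`h` by `I(g|h)` (`maxQuotient_eq_quotient_IR`), so the same statement applies to `h`. -/

/-! ### Orthogonality of central characters -/

instance : Finite g.Center :=
  Finite.of_injective (fun z : g.Center => z.1) fun _ _ H => ext_carrier H

/-- The evaluation of central characters at an element of `g`, as a character of the center. -/
noncomputable def evalHom {α : P} (hα : α ∈ g) : g.Center →* ℂ where
  toFun z := z.char α
  map_one' := char_one hα
  map_mul' z w := char_mul z w hα

theorem evalHom_apply {α : P} (hα : α ∈ g) (z : g.Center) : evalHom hα z = z.char α := rfl

theorem eq_one_iff (z : g.Center) : z = 1 ↔ ∀ α ∈ g, z.char α = 1 := by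
  constructor
  · rintro rfl α hα
    exact char_one hα
  · exact fun H => ext_char fun α hα => by rw [H α hα, char_one hα]

open Classical in
/-- Central characters are orthogonal with respect to the squared quantum dimensions. -/
theorem sum_char_eq_zero {z : g.Center} (hz : z ≠ 1) :
    ∑ α with α ∈ g, (M.qdim α : ℂ) ^ 2 * z.char α = 0 := by
  obtain ⟨q, hq⟩ := z.nonempty
  -- Since `z` is not the trivial class, `q` and the vacuum give different irreducible
  -- representations on `g`; their orthogonality is the claim, because the vacuum takes the value
  -- `M.qdim α` at `α`.
  have hq' : q ∉ g.classOf M.vac := fun hv => hz <| ext_carrier <| by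
    rw [z.eq_classOf hq, (1 : g.Center).eq_classOf (p := q) hv]
  rw [← sum_chi_eq_zero hq']
  refine Finset.sum_congr rfl fun α hα => ?_
  rw [z.chi_eq hq (Finset.mem_filter.1 hα).2, M.chi_vac_left, Complex.star_def,
    Complex.conj_ofReal]
  ring

end Center

-- The positive total left over at the end of both double counting arguments below.
variable (g) in
open Classical in
theorem sum_qdim_sq_ne_zero : ∑ α with α ∈ g, (M.qdim α : ℂ) ^ 2 ≠ 0 := by
  have : (0 : ℝ) < ∑ α with α ∈ g, M.qdim α ^ 2 :=
    Finset.sum_pos (fun α _ => pow_pos (M.qdim_pos α) 2)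
      ⟨M.vac, Finset.mem_filter.2 ⟨Finset.mem_univ _, g.vac_mem⟩⟩
  exact_mod_cast this.ne'

/-! ### The Galois connection between central quotients and subgroups of the center -/

theorem mem_quotient {H : Subgroup g.Center} {α : P} :
    α ∈ g.quotient H ↔ α ∈ g ∧ ∀ z ∈ H, z.char α = 1 := Iff.rfl

theorem quotient_le (H : Subgroup g.Center) : g.quotient H ≤ g := fun _ hα => hα.1

theorem quotient_anti {H K : Subgroup g.Center} (hHK : H ≤ K) : g.quotient K ≤ g.quotient H :=
  fun _ hα => ⟨hα.1, fun z hz => hα.2 z (hHK hz)⟩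

/-- Restriction leaves the values of a central character on `h` unchanged, so its kernel is the
annihilator of `h`. -/
theorem mem_ZR_iff_char (hle : h ≤ g) (z : g.Center) :
    z ∈ ZR hle ↔ ∀ α ∈ h, z.char α = 1 := by
  rw [ZR, MonoidHom.mem_ker, Center.eq_one_iff]
  exact forall₂_congr fun α hα => by rw [← char_resClass hle z hα]; rfl

theorem ZR_anti {j : M.DecLattice} (hjg : j ≤ g) (hhj : h ≤ j) :
    ZR hjg ≤ ZR (hhj.trans hjg) := fun z hz => by
  rw [mem_ZR_iff_char] at hz ⊢
  exact fun α hα => hz α (hhj hα)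

/-- The subgroup of the center that defines a central quotient can be recovered from it. -/
theorem ZR_quotient (H : Subgroup g.Center) : ZR (quotient_le H) = H := by
  classical
  have := Fintype.ofFinite H
  refine le_antisymm (fun z hz => ?_) fun z hz =>
    (mem_ZR_iff_char _ _).2 fun α hα => hα.2 z hz
  rw [mem_ZR_iff_char] at hz
  by_contra hzH
  -- As `z` lies outside `H`, no member of the coset `zH` is trivial, so each inner sum vanishes.
  have h0 : ∑ w : H, ∑ α with α ∈ g, (M.qdim α : ℂ) ^ 2 * (z * w.1).char α = 0 :=
    Finset.sum_eq_zero fun w _ => Center.sum_char_eq_zero fun hw => hzH <| by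
      rw [mul_eq_one_iff_eq_inv] at hw
      exact hw ▸ H.inv_mem w.2
  have h1 : ∀ α ∈ g, ∑ w : H, (M.qdim α : ℂ) ^ 2 * (z * w.1).char α
      = if α ∈ g.quotient H then (Fintype.card H : ℂ) * (M.qdim α : ℂ) ^ 2 else 0 := by
    intro α hα
    -- Summing over the coset first acts as a projection: evaluation at `α` is the trivial character
    -- of `H` exactly when `α` lies in the quotient, where moreover `z` is 1 by `hz`.
    have hs := sum_hom_units ((Center.evalHom hα).comp H.subtype)
    have he : (Center.evalHom hα).comp H.subtype = 1 ↔ α ∈ g.quotient H := by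
      rw [mem_quotient, and_iff_right hα, MonoidHom.ext_iff]
      exact Subtype.forall
    simp only [he, MonoidHom.comp_apply, Subgroup.subtype_apply, Center.evalHom_apply] at hs
    simp_rw [Center.char_mul _ _ hα, ← mul_assoc]
    rw [← Finset.mul_sum, hs]
    split_ifs with hq
    · rw [hz α hq]; ring
    · simp
  rw [Finset.sum_comm, Finset.sum_congr rfl fun α hα => h1 α (Finset.mem_filter.1 hα).2,
    ← Finset.sum_filter, Finset.filter_filter, ← Finset.mul_sum] at h0
  have h2 : (Finset.univ.filter fun α => α ∈ g ∧ α ∈ g.quotient H)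
      = Finset.univ.filter fun α => α ∈ g.quotient H :=
    Finset.filter_congr fun α _ => and_iff_right_of_imp fun hα => hα.1
  rw [h2] at h0
  exact mul_ne_zero (Nat.cast_ne_zero.2 Fintype.card_ne_zero)
    (sum_qdim_sq_ne_zero (g.quotient H)) h0

/-! ### Intermediate elements are central quotients -/

/-- Frobenius reciprocity: `α` occurs in the product of the conjugate of `γ` with `β`, both in `j`.
-/
theorem mem_of_fusion_conj {j : M.DecLattice} {α β γ : P} (hβ : β ∈ j) (hγ : γ ∈ j)
    (hN : 0 < M.N (M.conj α) β γ) : α ∈ j := by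
  rw [M.N_conj, M.N_comm, ← M.N_conj] at hN
  exact j.fusion_mem _ _ _ (conj_mem hγ) hβ hN

/-- If `α` is annihilated by all central characters trivial on `j`, then some element of `j` has
the same values as `α` under the characters in a given subgroup of the center. -/
theorem exists_mem_char_conj_mul_eq_one {j : M.DecLattice} (hjg : j ≤ g) (K : Subgroup g.Center)
    {α : P} (hα : α ∈ g.quotient (ZR hjg)) :
    ∃ β ∈ j, ∀ z ∈ K, z.char (M.conj α) * z.char β = 1 := by
  classical
  have := Fintype.ofFinite K
  have hα' := conj_mem hα
  by_contra! hne
  -- If no `β` works, each inner sum runs over the values of a nontrivial character of `K`.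
  have h0 : ∑ β with β ∈ j, (M.qdim β : ℂ) ^ 2 *
      ∑ w : K, w.1.char (M.conj α) * w.1.char β = 0 := by
    refine Finset.sum_eq_zero fun β hβ => ?_
    have hβj := (Finset.mem_filter.1 hβ).2
    have hs := sum_hom_units_eq_zero
      ((Center.evalHom hα'.1 * Center.evalHom (hjg hβj)).comp K.subtype) fun he => by
        obtain ⟨z, hz, hzne⟩ := hne β hβj
        have hv := DFunLike.congr_fun he ⟨z, hz⟩
        simp only [MonoidHom.comp_apply, MonoidHom.mul_apply, Subgroup.subtype_apply,
          Center.evalHom_apply, MonoidHom.one_apply] at hv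
        exact hzne hv
    simp only [MonoidHom.comp_apply, MonoidHom.mul_apply, Subgroup.subtype_apply,
      Center.evalHom_apply] at hs
    rw [hs, mul_zero]
  have h1 : ∀ w : K, ∑ β with β ∈ j,
      (M.qdim β : ℂ) ^ 2 * (w.1.char (M.conj α) * w.1.char β)
      = if w.1 ∈ ZR hjg then ∑ β with β ∈ j, (M.qdim β : ℂ) ^ 2 else 0 := by
    intro w
    split_ifs with hw
    · refine Finset.sum_congr rfl fun β hβ => ?_
      rw [hα'.2 _ hw, (mem_ZR_iff_char hjg _).1 hw β (Finset.mem_filter.1 hβ).2]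
      simp
    -- Outside the kernel the restriction of `w` is a nontrivial central class of `j`, so
    -- orthogonality is used over `j` rather than `g`.
    · have hs := Center.sum_char_eq_zero (z := res hjg w.1) hw
      rw [← mul_zero (w.1.char (M.conj α)), ← hs, Finset.mul_sum]
      refine Finset.sum_congr rfl fun β hβ => ?_
      rw [show (res hjg w.1).char β = w.1.char β from
        char_resClass hjg _ (Finset.mem_filter.1 hβ).2]
      ring
  simp_rw [Finset.mul_sum] at h0
  rw [Finset.sum_comm] at h0
  simp_rw [h1] at h0
  rw [← Finset.sum_filter, Finset.sum_const, nsmul_eq_mul] at h0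
  -- The surviving terms are indexed by the elements of `K` in `ZR hjg`, among which is the
  -- identity.
  refine mul_ne_zero (Nat.cast_ne_zero.2 (Finset.card_pos.2 ⟨1, ?_⟩).ne')
    (sum_qdim_sq_ne_zero j) h0
  exact Finset.mem_filter.2 ⟨Finset.mem_univ _, (ZR hjg).one_mem⟩

/-- Every element of the deconstruction lattice between `g` and a central quotient of `g` is
a central quotient of `g`. -/
theorem quotient_ZR {j : M.DecLattice} (hjg : j ≤ g) {K : Subgroup g.Center}
    (hK : g.quotient K ≤ j) : g.quotient (ZR hjg) = j := by
  refine le_antisymm (fun α hα => ?_) fun α hα =>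
    ⟨hjg hα, fun z hz => (mem_ZR_iff_char hjg z).1 hz α hα⟩
  obtain ⟨β, hβ, H⟩ := exists_mem_char_conj_mul_eq_one hjg K hα
  -- Every character in `K` is 1 on any constituent `γ` of this product, which puts `γ` in
  -- `g.quotient K`, hence in `j`; reciprocity then recovers `α`.
  obtain ⟨γ, hγ⟩ := M.exists_N_pos (M.conj α) β
  have hα' : M.conj α ∈ g := conj_mem hα.1
  exact mem_of_fusion_conj hβ (hK ⟨g.fusion_mem _ _ _ hα' (hjg hβ) hγ, fun z hz => by
    rw [z.char_fusion hα' (hjg hβ) hγ, H z hz]⟩) hγ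

/-! ### Intervals of the lattice and the two correspondences -/

/-- The interval between `g` and its central quotient `l = g / K` is anti-isomorphic to the
subgroup lattice of `K`. -/
noncomputable def iccEquivSubgroup {l : M.DecLattice} {K : Subgroup g.Center}
    (hl : l = g.quotient K) : Set.Icc l g ≃ Subgroup K where
  toFun j := (ZR j.2.2).subgroupOf K
  invFun H := ⟨g.quotient (H.map K.subtype),
    hl ▸ quotient_anti (Subgroup.map_subtype_le H), quotient_le _⟩
  left_inv j := Subtype.ext <| by
    subst hl
    -- Because `j` contains `g.quotient K`, its annihilator already lies in `K`, so passing to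
    -- `Subgroup K` loses nothing.
    have hZ : ZR j.2.2 ≤ K := (ZR_anti j.2.2 j.2.1).trans (ZR_quotient K).le
    change g.quotient (((ZR j.2.2).subgroupOf K).map K.subtype) = j.1
    rw [Subgroup.map_subgroupOf_eq_of_le hZ, quotient_ZR j.2.2 j.2.1]
  right_inv H := by
    change (ZR (quotient_le (H.map K.subtype))).subgroupOf K = H
    rw [ZR_quotient]
    exact Subgroup.comap_map_eq_self_of_injective K.subtype_injective H

theorem map_iccEquivSubgroup {l : M.DecLattice} {K : Subgroup g.Center}
    (hl : l = g.quotient K) (j : Set.Icc l g) :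
    (iccEquivSubgroup hl j).map K.subtype = ZR j.2.2 := by
  subst hl
  exact Subgroup.map_subgroupOf_eq_of_le ((ZR_anti j.2.2 j.2.1).trans (ZR_quotient K).le)

/-- On `h` the characters from `I(g|h)` take the values of those from the whole center of `g`, so
both impose the same conditions. That `h` is a central quotient ensures that it contains
`g.maxQuotient`. -/
theorem maxQuotient_eq_quotient_IR (hgh : h.IsCentralQuotient g) :
    g.maxQuotient = h.quotient (IR hgh.le) := by
  have hle : g.maxQuotient ≤ h := by
    obtain ⟨H, rfl⟩ := hgh
    exact quotient_anti le_top
  apply le_antisymm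
  · intro α hα
    refine mem_quotient.2 ⟨hle hα, ?_⟩
    rintro _ ⟨z, rfl⟩
    exact (char_resClass hgh.le z (hle hα)).trans ((mem_quotient.1 hα).2 z (Subgroup.mem_top z))
  · intro α hα
    obtain ⟨hαh, hc⟩ := mem_quotient.1 hα
    refine mem_quotient.2 ⟨hgh.le hαh, fun z _ => ?_⟩
    rw [← char_resClass hgh.le z hαh]
    exact hc _ ⟨z, rfl⟩

end DecLattice

end ConformalModel

theorem mainTheorem7 {P : Type*} [Fintype P] [DecidableEq P] (M : ConformalModel P)
    (g h : M.DecLattice) (hgh : h.IsCentralQuotient g) :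
    (∃ e : Set.Icc h g ≃ Subgroup (ConformalModel.DecLattice.ZR hgh.le),
      (∀ j : Set.Icc h g,
        (e j).map (ConformalModel.DecLattice.ZR hgh.le).subtype = ConformalModel.DecLattice.ZR (g := g) (h := j.1) j.2.2) ∧
      ∀ H : Subgroup (ConformalModel.DecLattice.ZR hgh.le),
        (e.symm H).1 = g.quotient (H.map (ConformalModel.DecLattice.ZR hgh.le).subtype)) ∧
    (∃ e : Set.Icc g.maxQuotient h ≃ Subgroup (ConformalModel.DecLattice.IR hgh.le),
      (∀ j : Set.Icc g.maxQuotient h,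
        (e j).map (ConformalModel.DecLattice.IR hgh.le).subtype = ConformalModel.DecLattice.ZR (g := h) (h := j.1) j.2.2) ∧
      ∀ H : Subgroup (ConformalModel.DecLattice.IR hgh.le),
        (e.symm H).1 = h.quotient (H.map (ConformalModel.DecLattice.IR hgh.le).subtype)) := by
  -- The subgroup witnessing that `h` is a central quotient is replaced by the canonical one,
  -- `Z(g|h)`.
  have hh : h = g.quotient (ConformalModel.DecLattice.ZR hgh.le) := by
    obtain ⟨K, hK⟩ := hgh
    exact (ConformalModel.DecLattice.quotient_ZR _ hK.ge).symm
  have hm := ConformalModel.DecLattice.maxQuotient_eq_quotient_IR hgh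
  exact ⟨⟨ConformalModel.DecLattice.iccEquivSubgroup hh,
      ConformalModel.DecLattice.map_iccEquivSubgroup hh, fun _ => rfl⟩,
    ⟨ConformalModel.DecLattice.iccEquivSubgroup hm,
      ConformalModel.DecLattice.map_iccEquivSubgroup hm, fun _ => rfl⟩⟩
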